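/- \textbf{Setting.} Let $A\in\{0,*\}^{n\times n}$ and $B\in\{0,*\}^{n\times m}$ be structured matrices; a realization of a structured matrix is a real matrix that vanishes at every entry marked $0$. The pair $(A,B)$ is structurally controllable if it has realizations $\tilde A,\tilde B$ such that $\dot x=\tilde Ax+\tilde Bu$ is controllable. Assume that $(A,B)$ is structurally controllable and that every $*$ entry $B_{ij}$ carries a cost $0\le w_{ij}<\infty$. Let $k\in\mathbb N$. Write $X_L=\{x_1^L,\dots,x_n^L\}$, $X_R=\{x_1^R,\dots,x_n^R\}$, $U=\{u_1,\dots,u_m\}$, $E_{XX}=\{(x_j^R,x_i^L):A_{ij}=*\}$ and $E_{UX}=\{(u_j,x_i^L):B_{ij}=*\}$ (the input links), with $w_{u_jx_i^L}=w_{ij}$. The state digraph has vertices $x_1,\dots,x_n$ and edges $(x_j,x_i)$ for $A_{ij}=*$. A source SCC is a strongly connected component of it with no incoming edge from another component. Let $\mathcal I$ index the source SCCs, and for $i\in\mathcal I$ let $E_i\subseteq E_{UX}$ be the set of input links that end in the $i$-th one, and $w_i^{\min}=\min_{e\in E_i}w_e$. \textbf{Selection problems.} Let $B'$ range over the structured $n\times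 m$ matrices whose $*$ entries are among those of $B$ and for which $(A,B')$ is structurally controllable. $\mathcal P_1$ minimizes the number $\|B'\|_0$ of $*$ entries of $B'$; $\mathcal P_2$ minimizes the sum $\|B'\|_w$ of the costs of the $*$ entries of $B'$; $\mathcal P_3$ minimizes $\|B'\|_w$ subject to $\|B'\|_0\le k$. \textbf{Integer programs.} The variables are $y_{uv}\in\{0,1\}$ for $(u,v)\in E_{XX}\cup E_{UX}$ and $z_i\in\{0,1\}$ for $i\in\mathcal I$, with the constraints $$\sum_{u:(u,v)\in E_{XX}\cup E_{UX}}y_{uv}=1\ (v\in X_L),\qquad \sum_{v:(u,v)\in E_{XX}\cup E_{UX}}y_{uv}\le1\ (u\in X_R\cup U),\qquad z_i\le\sum_{(u,v)\in E_i}y_{uv}\ (i\in\mathcal I).$$ Under these constraints, $\mathcal P_1^{\rm ILP}$ minimizes $\sum_{(u,v)\in E_{UX}}y_{uv}+|\mathcal I|-\sum_{i\in\mathcal I}z_i$, and $\mathcal P_2^{\rm ILP}$ minimizes $\sum_{(u,v)\in E_{UX}}w_{uv}y_{uv}+\sum_{i\in\mathcal I}(1-z_i)w_i^{\min}$; $\mathcal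 P_3^{\rm ILP}$ is $\mathcal P_2^{\rm ILP}$ with the additional constraint $\sum_{(u,v)\in E_{UX}}y_{uv}+|\mathcal I|-\sum_{i\in\mathcal I}z_i\le k$. \textbf{Theorem.} For each $i\in\mathcal I$ let $e_i^{\min}\in E_i$ be an input link with $w_{e_i^{\min}}=w_i^{\min}$; for $\mathcal P_1$, $e_i^{\min}$ may be any element of $E_i$. Let $l\in\{1,2,3\}$ and let $(y^\star,z^\star)$ be an optimal solution of $\mathcal P_l^{\rm ILP}$. Put $$E_{\rm mat}^\star=\{(u,v)\in E_{UX}:y^\star_{uv}=1\},\qquad E_{\rm rea}^\star=\{e_i^{\min}:i\in\mathcal I,\ z_i^\star=0\}.$$ Then $E_{\rm mat}^\star\cup E_{\rm rea}^\star$ is the set of input links of an optimal solution of $\mathcal P_l$. -/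

import Mathlib

namespace StructuredSystem

/-- A structured matrix in `{0,*}^{a × b}`: the entry `true` stands for `*` (free), the entry
`false` for a fixed zero. -/
abbrev StructuredMatrix (a b : ℕ) := Matrix (Fin a) (Fin b) Bool

/-- The set of real realizations of a structured matrix. -/
def realizations {a b : ℕ} (M : StructuredMatrix a b) : Set (Matrix (Fin a) (Fin b) ℝ) :=
  {R | ∀ i j, M i j = false → R i j = 0}

/-- Controllability of `x'(t) = A x(t) + B u(t)`: every initial state can be steered to every
final state in finite time by some (continuous) input. -/
def Controllable {n m : ℕ} (A : Matrix (Fin n) (Fin n) ℝ) (B : Matrix (Fin n) (Fin m) ℝ) : Prop :=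
  ∀ x₀ x₁ : Fin n → ℝ, ∃ T : ℝ, 0 < T ∧
    ∃ (u : ℝ → Fin m → ℝ) (x : ℝ → Fin n → ℝ),
      ContinuousOn u (Set.Icc 0 T) ∧ x 0 = x₀ ∧ x T = x₁ ∧
      ∀ t ∈ Set.Icc (0 : ℝ) T,
        HasDerivWithinAt x (A.mulVec (x t) + B.mulVec (u t)) (Set.Icc 0 T) t

/-- Structural controllability: some realization is controllable. -/
def StructurallyControllable {n m : ℕ} (A : StructuredMatrix n n) (B : StructuredMatrix n m) :
    Prop :=
  ∃ A' ∈ realizations A, ∃ B' ∈ realizations B, Controllable A' B'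

/-- The state edges `(x_j, x_i)`, one for each `A i j = *`; also the edges `(x_j^R, x_i^L)` of the
bipartite graph. -/
def stateEdges {n : ℕ} (A : StructuredMatrix n n) : Finset (Fin n × Fin n) :=
  Finset.univ.filter fun e => A e.2 e.1 = true

/-- The input links `(u_j, x_i)`, one for each `B i j = *`; also the edges `(u_j, x_i^L)` of the
bipartite graph. -/
def inputLinks {n m : ℕ} (B : StructuredMatrix n m) : Finset (Fin m × Fin n) :=
  Finset.univ.filter fun e => B e.2 e.1 = true

/-- `Reach A i j`: there is a (possibly empty) path from `x_i` to `x_j` in the state digraph. -/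
def Reach {n : ℕ} (A : StructuredMatrix n n) (i j : Fin n) : Prop :=
  Relation.ReflTransGen (fun a b => (a, b) ∈ stateEdges A) i j

/-- `S` is the vertex set of a strongly connected component of the state digraph. -/
def IsSCC {n : ℕ} (A : StructuredMatrix n n) (S : Finset (Fin n)) : Prop :=
  S.Nonempty ∧ ∀ i ∈ S, ∀ j, j ∈ S ↔ Reach A i j ∧ Reach A j i

/-- An SCC without incoming edges from vertices outside of it. -/
def IsSourceSCC {n : ℕ} (A : StructuredMatrix n n) (S : Finset (Fin n)) : Prop :=
  IsSCC A S ∧ ∀ i j, i ∉ S → j ∈ S → (i, j) ∉ stateEdges A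

open Classical in
/-- The source SCCs, each represented by its vertex set. -/
noncomputable def sourceSCCs {n : ℕ} (A : StructuredMatrix n n) : Finset (Finset (Fin n)) :=
  Finset.univ.filter (IsSourceSCC A)

/-- The input links that end in the vertex set `S`. -/
def linksInto {n m : ℕ} (B : StructuredMatrix n m) (S : Finset (Fin n)) :
    Finset (Fin m × Fin n) :=
  (inputLinks B).filter fun e => e.2 ∈ S

/-- The minimum cost of an input link into `S` (used only where such links exist; the infimum is
then over a nonempty finite set). -/
noncomputable def minCost {n m : ℕ} (B : StructuredMatrix n m) (w : Matrix (Fin n) (Fin m) ℝ)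
    (S : Finset (Fin n)) : ℝ :=
  sInf ((fun e : Fin m × Fin n => w e.2 e.1) '' (linksInto B S : Set (Fin m × Fin n)))

/-- `x` is an optimal solution of `min {φ x : x ∈ Λ}`. -/
def IsOptimalSolution {α : Type*} (φ : α → ℝ) (Λ : Set α) (x : α) : Prop :=
  x ∈ Λ ∧ ∀ x' ∈ Λ, φ x ≤ φ x'

/-! The three input selection problems. -/

/-- `‖B‖₀`. -/
def sparsity {n m : ℕ} (B : StructuredMatrix n m) : ℕ := (inputLinks B).card

/-- `‖B‖_w`. -/
def cost {n m : ℕ} (w : Matrix (Fin n) (Fin m) ℝ) (B : StructuredMatrix n m) : ℝ :=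
  ∑ e ∈ inputLinks B, w e.2 e.1

/-- The `B'` whose `*` entries are among those of `B` and with `(A, B')` structurally controllable:
the feasible region of the sparsest and of the minimum cost input selection problem. -/
def selections {n m : ℕ} (A : StructuredMatrix n n) (B : StructuredMatrix n m) :
    Set (StructuredMatrix n m) :=
  {B' | inputLinks B' ⊆ inputLinks B ∧ StructurallyControllable A B'}

/-- The feasible region of the minimum cost `k`-sparsity input selection problem. -/
def sparseSelections {n m : ℕ} (A : StructuredMatrix n n) (B : StructuredMatrix n m) (k : ℕ) :
    Set (StructuredMatrix n m) :=
  {B' | B' ∈ selections A B ∧ sparsity B' ≤ k}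

/-! The integer linear programs. -/

/-- The decision variables: `y` on the state edges (`yX`) and on the input links (`yU`), and `z` on
the source SCCs. -/
structure Variables {n m : ℕ} (A : StructuredMatrix n n) (B : StructuredMatrix n m) where
  yX : stateEdges A → ℝ
  yU : inputLinks B → ℝ
  z : sourceSCCs A → ℝ

/-- The constraints shared by the three programs. -/
structure Variables.IsFeasible {n m : ℕ} {A : StructuredMatrix n n} {B : StructuredMatrix n m}
    (v : Variables A B) : Prop where
  left : ∀ i : Fin n, ∑ e : stateEdges A with e.1.2 = i, v.yX e
    + ∑ e : inputLinks B with e.1.2 = i, v.yU e = 1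
  right_state : ∀ j : Fin n, ∑ e : stateEdges A with e.1.1 = j, v.yX e ≤ 1
  right_input : ∀ j : Fin m, ∑ e : inputLinks B with e.1.1 = j, v.yU e ≤ 1
  scc : ∀ S : sourceSCCs A, v.z S ≤ ∑ e : inputLinks B with e.1 ∈ linksInto B S.1, v.yU e
  binary_yX : ∀ e, v.yX e = 0 ∨ v.yX e = 1
  binary_yU : ∀ e, v.yU e = 0 ∨ v.yU e = 1
  binary_z : ∀ S, v.z S = 0 ∨ v.z S = 1

/-- `∑ y_{uv} + |I| - ∑ z_i`. -/
noncomputable def Variables.count {n m : ℕ} {A : StructuredMatrix n n} {B : StructuredMatrix n m}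
    (v : Variables A B) : ℝ :=
  ∑ e, v.yU e + (sourceSCCs A).card - ∑ S, v.z S

/-- `∑ w_{uv} y_{uv} + ∑ (1 - z_i) w_i^min`. -/
noncomputable def Variables.cost {n m : ℕ} {A : StructuredMatrix n n} {B : StructuredMatrix n m}
    (w : Matrix (Fin n) (Fin m) ℝ) (v : Variables A B) : ℝ :=
  ∑ e : inputLinks B, w e.1.2 e.1.1 * v.yU e
    + ∑ S : sourceSCCs A, (1 - v.z S) * minCost B w S.1

/-- The feasible region of the first two programs. -/
def ilpRegion {n m : ℕ} (A : StructuredMatrix n n) (B : StructuredMatrix n m) :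
    Set (Variables A B) :=
  {v | v.IsFeasible}

/-- The feasible region of the third program. -/
def ilpSparseRegion {n m : ℕ} (A : StructuredMatrix n n) (B : StructuredMatrix n m) (k : ℕ) :
    Set (Variables A B) :=
  {v | v.IsFeasible ∧ v.count ≤ k}

/-- The input links with `y = 1`. -/
def matLinks {n m : ℕ} {A : StructuredMatrix n n} {B : StructuredMatrix n m}
    (v : Variables A B) : Set (Fin m × Fin n) :=
  {e | ∃ h : e ∈ inputLinks B, v.yU ⟨e, h⟩ = 1}

/-- The selected links `sel i` into the source SCCs `i` with `z_i = 0`. -/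
def reaLinks {n m : ℕ} {A : StructuredMatrix n n} {B : StructuredMatrix n m}
    (sel : sourceSCCs A → Fin m × Fin n) (v : Variables A B) : Set (Fin m × Fin n) :=
  {e | ∃ S, v.z S = 0 ∧ e = sel S}

end StructuredSystem

open StructuredSystem

/-! Structural controllability is combinatorial (`structurallyControllable_iff`): it holds exactly
when a matching of states and inputs covers every left state vertex and every source SCC receives an
input link. Necessity: the rows of a controllable `[A B]` are independent, so Hall's condition
holds, and states cut off from outside cannot leave zero. Sufficiency: take a rational matrix with
the given pattern and independent rows, and scale the rows by algebraically independent numbers. A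
left eigenvector violating the Hautus test would put too many of these numbers into a field with too
few generators.

Feasible `y` encode such matchings, and `z` records source SCCs reached by matched links. A feasible
point gives a selection, its matched links plus one link per SCC with `z = 0`, that costs no more
than the objective (`exists_selection`). Conversely, a selection gives a feasible point whose
objective is no larger than its cost (`exists_isFeasible_of_mem_selections`). Both hold for all
nonnegative costs at once, so count and weight are controlled simultaneously, as the sparsity bound
requires. Chaining the two inequalities through the optimum of the program yields optimality. -/

namespace StructuredSystem

/-! ### Steering by compensation and the Hautus test -/

/-- The directions `v` such that every smooth disturbance `h • v` which vanishes near the end points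
of `[0, 1]` can be compensated on a trajectory from `0` to `0`. -/
def compensable {n m : ℕ} (A : Matrix (Fin n) (Fin n) ℝ) (B : Matrix (Fin n) (Fin m) ℝ) :
    Submodule ℝ (Fin n → ℝ) where
  carrier := {v | ∀ h : ℝ → ℝ, ContDiff ℝ (⊤ : ℕ∞) h → h =ᶠ[nhds 0] 0 → h =ᶠ[nhds 1] 0 →
    ∃ (p : ℝ → Fin n → ℝ) (q : ℝ → Fin m → ℝ), Continuous q ∧ p 0 = 0 ∧ p 1 = 0 ∧
      ∀ t, HasDerivAt p (A.mulVec (p t) + B.mulVec (q t) + h t • v) t}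
  zero_mem' := fun h _ _ _ => ⟨0, 0, continuous_const, rfl, rfl, fun t => by
    simp⟩
  add_mem' := by
    intro a b ha hb h hs h0 h1
    obtain ⟨p, q, hq, hp0, hp1, hp⟩ := ha h hs h0 h1
    obtain ⟨p', q', hq', hp0', hp1', hp'⟩ := hb h hs h0 h1
    refine ⟨p + p', q + q', hq.add hq', by simp [hp0, hp0'], by simp [hp1, hp1'], fun t => ?_⟩
    refine ((hp t).add (hp' t)).congr_deriv ?_
    simp only [Pi.add_apply, Matrix.mulVec_add, smul_add]
    abel
  smul_mem' := by
    intro c a ha h hs h0 h1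
    obtain ⟨p, q, hq, hp0, hp1, hp⟩ := ha h hs h0 h1
    refine ⟨c • p, c • q, hq.const_smul c, by simp [hp0], by simp [hp1], fun t => ?_⟩
    refine ((hp t).const_smul c).congr_deriv ?_
    simp only [Pi.smul_apply, Matrix.mulVec_smul, smul_add, smul_comm c]

theorem mulVec_input_mem_compensable {n m : ℕ} (A : Matrix (Fin n) (Fin n) ℝ)
    (B : Matrix (Fin n) (Fin m) ℝ) (u : Fin m → ℝ) : B.mulVec u ∈ compensable A B := by
  intro h hs _ _
  refine ⟨0, fun t => -(h t • u), (hs.continuous.smul continuous_const).neg, rfl, rfl,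
    fun t => ?_⟩
  simp [Matrix.mulVec_neg, Matrix.mulVec_smul]

/-- Integration by parts: if `p` compensates `h' • v`, then `p - h • v` compensates `h • A v`.
Vanishing near the end points, not merely at them, is what `h'` inherits from `h`. -/
theorem mulVec_state_mem_compensable {n m : ℕ} {A : Matrix (Fin n) (Fin n) ℝ}
    {B : Matrix (Fin n) (Fin m) ℝ} {v : Fin n → ℝ} (hv : v ∈ compensable A B) :
    A.mulVec v ∈ compensable A B := by
  intro h hs h0 h1
  obtain ⟨p, q, hq, hp0, hp1, hp⟩ := hv (deriv h)
    ((contDiff_infty_iff_deriv.1 hs).2)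
    (h0.deriv.trans (by simp)) (h1.deriv.trans (by simp))
  refine ⟨fun t => p t - h t • v, q, hq, by simp [hp0, h0.eq_of_nhds], by
    simp [hp1, h1.eq_of_nhds], fun t => ?_⟩
  have hd : HasDerivAt h (deriv h t) t :=
    ((contDiff_infty_iff_deriv.1 hs).1 t).hasDerivAt
  refine ((hp t).sub (hd.smul_const v)).congr_deriv ?_
  simp only [Matrix.mulVec_sub, Matrix.mulVec_smul]
  abel

/-- The free motion through `x` at time `0`. -/
theorem exists_smooth_free_motion {n : ℕ} (A : Matrix (Fin n) (Fin n) ℝ) (x : Fin n → ℝ) :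
    ∃ f : ℝ → Fin n → ℝ, ContDiff ℝ (⊤ : ℕ∞) f ∧ f 0 = x ∧
      ∀ t, HasDerivAt f (A.mulVec (f t)) t := by
  let L : (Fin n → ℝ) →L[ℝ] (Fin n → ℝ) := LinearMap.toContinuousLinearMap (Matrix.toLin' A)
  refine ⟨fun t => NormedSpace.exp (t • L) x, ?_, by simp, fun t => ?_⟩
  · have h : ContDiff ℝ (⊤ : ℕ∞) (NormedSpace.exp : ((Fin n → ℝ) →L[ℝ] (Fin n → ℝ)) → _) :=
      contDiff_iff_contDiffAt.2 fun y => (NormedSpace.exp_analytic (𝕂 := ℝ) y).contDiffAt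
    exact (h.comp (contDiff_id.smul contDiff_const)).clm_apply contDiff_const
  · have h := (hasDerivAt_exp_smul_const' (𝕂 := ℝ) L t).clm_apply (hasDerivAt_const t x)
    simpa [L] using h

/-- Blend the free motion leaving `x₀` into the one arriving at `x₁`. The blend violates the free
equation by `χ' • (g - f)`, which vanishes near both ends and can be compensated coordinate by
coordinate. -/
theorem controllable_of_compensable_eq_top {n m : ℕ} {A : Matrix (Fin n) (Fin n) ℝ}
    {B : Matrix (Fin n) (Fin m) ℝ} (h : compensable A B = ⊤) : Controllable A B := by
  intro x₀ x₁
  obtain ⟨f, hfs, hf0, hf⟩ := exists_smooth_free_motion A x₀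
  obtain ⟨g', hgs', hg0', hg'⟩ := exists_smooth_free_motion A x₁
  obtain ⟨g, hgs, hg1, hg⟩ : ∃ g : ℝ → Fin n → ℝ, ContDiff ℝ (⊤ : ℕ∞) g ∧ g 1 = x₁ ∧
      ∀ t, HasDerivAt g (A.mulVec (g t)) t :=
    ⟨fun t => g' (t - 1), hgs'.comp (contDiff_id.sub contDiff_const), by simp [hg0'],
      fun t => (hg' (t - 1)).comp_sub_const t 1⟩
  -- The factor 3 makes `χ` constant on both sides of `[1/3, 2/3]`, hence near 0 and near 1.
  let χ : ℝ → ℝ := fun t => Real.smoothTransition (3 * t - 1)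
  have hχs : ContDiff ℝ (⊤ : ℕ∞) χ :=
    Real.smoothTransition.contDiff.comp ((contDiff_const.mul contDiff_id).sub contDiff_const)
  have hχ0 : χ =ᶠ[nhds 0] fun _ => 0 := by
    filter_upwards [Iio_mem_nhds (show (0 : ℝ) < 1 / 3 by norm_num)] with t ht
    exact Real.smoothTransition.zero_of_nonpos (by linarith [Set.mem_Iio.1 ht])
  have hχ1 : χ =ᶠ[nhds 1] fun _ => 1 := by
    filter_upwards [Ioi_mem_nhds (show (2 / 3 : ℝ) < 1 by norm_num)] with t ht
    exact Real.smoothTransition.one_of_one_le (by linarith [Set.mem_Ioi.1 ht])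
  have hdχ : ∀ t, HasDerivAt χ (deriv χ t) t := fun t =>
    ((contDiff_infty_iff_deriv.1 hχs).1 t).hasDerivAt
  have hdχ0 : deriv χ =ᶠ[nhds 0] 0 := hχ0.deriv.trans (by simp; rfl)
  have hdχ1 : deriv χ =ᶠ[nhds 1] 0 := hχ1.deriv.trans (by simp; rfl)
  have key : ∀ i : Fin n, ∃ (p : ℝ → Fin n → ℝ) (q : ℝ → Fin m → ℝ), Continuous q ∧ p 0 = 0 ∧
      p 1 = 0 ∧ ∀ t, HasDerivAt p
        (A.mulVec (p t) + B.mulVec (q t) + (deriv χ t * (g t i - f t i)) • Pi.single i 1) t := by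
    intro i
    have hi : (Pi.single i 1 : Fin n → ℝ) ∈ compensable A B := h ▸ Submodule.mem_top
    refine hi (fun t => deriv χ t * (g t i - f t i)) ?_ ?_ ?_
    · exact (contDiff_infty_iff_deriv.1 hχs).2.mul
        ((contDiff_pi.1 hgs i).sub (contDiff_pi.1 hfs i))
    · filter_upwards [hdχ0] with t ht
      simp [ht]
    · filter_upwards [hdχ1] with t ht
      simp [ht]
  choose p q hq hp0 hp1 hp using key
  refine ⟨1, one_pos, fun t => -∑ i, q i t,
    fun t => f t + χ t • (g t - f t) - ∑ i, p i t, ?_, ?_, ?_, ?_⟩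
  · exact (continuous_finsetSum _ fun i _ => hq i).neg.continuousOn
  · simp [hp0, hχ0.eq_of_nhds, hf0]
  · simp [hp1, hχ1.eq_of_nhds, hg1]
  · intro t _
    have hsum : HasDerivAt (fun t => ∑ i, p i t) (∑ i, (A.mulVec (p i t) + B.mulVec (q i t)
        + (deriv χ t * (g t i - f t i)) • (Pi.single i 1 : Fin n → ℝ))) t :=
      HasDerivAt.fun_sum fun i _ => hp i t
    have hx := ((hf t).add ((hdχ t).smul ((hg t).sub (hf t)))).sub hsum
    refine HasDerivAt.hasDerivWithinAt ?_
    refine hx.congr_deriv (Eq.symm ?_)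
    have hdec : ∑ i, (deriv χ t * (g t i - f t i)) • (Pi.single i 1 : Fin n → ℝ)
        = deriv χ t • (g t - f t) := by
      ext j
      simp [Finset.sum_apply, Pi.single_apply]
    have hB : B.mulVec (∑ i, q i t) = ∑ i, B.mulVec (q i t) := map_sum B.mulVecLin _ _
    have hA : A.mulVec (∑ i, p i t) = ∑ i, A.mulVec (p i t) := map_sum A.mulVecLin _ _
    simp only [Finset.sum_add_distrib, hdec, Matrix.mulVec_sub, Matrix.mulVec_add,
      Matrix.mulVec_smul, Matrix.mulVec_neg, hA, hB, Pi.sub_apply]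
    abel

/-- The Hautus test. -/
theorem controllable_of_left_eigenvector_eq_zero {n m : ℕ} {A : Matrix (Fin n) (Fin n) ℝ}
    {B : Matrix (Fin n) (Fin m) ℝ}
    (h : ∀ (r : ℂ) (v : Fin n → ℂ), (∀ j, ∑ i, v i * (A i j : ℂ) = r * v j) →
      (∀ j, ∑ i, v i * (B i j : ℂ) = 0) → v = 0) : Controllable A B := by
  refine controllable_of_compensable_eq_top ?_
  by_contra hne
  obtain ⟨φ, hφ0, hφ⟩ := Submodule.exists_le_ker_of_lt_top _ (lt_top_iff_ne_top.2 hne)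
  let AC : Matrix (Fin n) (Fin n) ℂ := A.map Complex.ofReal
  let BC : Matrix (Fin n) (Fin m) ℂ := B.map Complex.ofReal
  -- `W` is the complexified annihilator of all `A ^ k B`. It is invariant under `A` and contains
  -- the nonzero functional `φ`, so over `ℂ` it contains a left eigenvector; the condition for `k =
  -- 0` says that `B` annihilates it.
  let W : Submodule ℂ (Fin n → ℂ) := ⨅ k : ℕ, LinearMap.ker ((AC ^ k * BC).vecMulLinear)
  have hW : ∀ v, v ∈ W ↔ ∀ k : ℕ, Matrix.vecMul v (AC ^ k * BC) = 0 := by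
    intro v
    simp [W, Submodule.mem_iInf]
  have hpow : ∀ (k : ℕ) (u : Fin m → ℝ), (A ^ k * B).mulVec u ∈ compensable A B := by
    intro k u
    induction k with
    | zero => simpa using mulVec_input_mem_compensable A B u
    | succ k ih =>
      rw [pow_succ', Matrix.mul_assoc, ← Matrix.mulVec_mulVec]
      exact mulVec_state_mem_compensable ih
  let c : Fin n → ℝ := fun i => φ (Pi.single i 1)
  have hc : ∀ x, φ x = ∑ i, c i * x i := by
    intro x
    conv_lhs => rw [pi_eq_sum_univ' x]
    simp [c, mul_comm]
  have hcW : (fun i => (c i : ℂ)) ∈ W := by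
    rw [hW]
    intro k
    ext j
    have h1 : φ ((A ^ k * B).mulVec (Pi.single j 1)) = 0 := hφ (hpow k _)
    rw [hc] at h1
    have h2 : AC ^ k * BC = (A ^ k * B).map Complex.ofReal := by
      have h3 := map_pow (Complex.ofRealHom.mapMatrix (m := Fin n)) A k
      have h4 : (A ^ k * B).map Complex.ofRealHom =
        (A ^ k).map Complex.ofRealHom * B.map Complex.ofRealHom := Matrix.map_mul
      exact (h4.trans (congrArg (· * B.map Complex.ofRealHom) h3)).symm
    rw [h2]
    simp only [Matrix.mulVec_single_one, Matrix.col_apply] at h1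
    simp only [Matrix.vecMul, dotProduct, Matrix.map_apply, Pi.zero_apply]
    exact_mod_cast h1
  have hinv : ∀ v ∈ W, Matrix.vecMul v AC ∈ W := by
    intro v hv
    rw [hW] at hv ⊢
    intro k
    rw [Matrix.vecMul_vecMul, ← Matrix.mul_assoc, ← pow_succ']
    exact hv (k + 1)
  have hWne : Nontrivial W := by
    refine ⟨⟨⟨_, hcW⟩, 0, fun h0 => hφ0 ?_⟩⟩
    refine LinearMap.ext fun x => ?_
    rw [hc]
    refine Finset.sum_eq_zero fun i _ => ?_
    have h1 := congrFun (congrArg Subtype.val h0) i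
    have h2 : c i = 0 := by simpa using h1
    simp [h2]
  obtain ⟨r, hr⟩ := Module.End.exists_eigenvalue (AC.vecMulLinear.restrict hinv)
  obtain ⟨v, hv⟩ := hr.exists_hasEigenvector
  have hv1 : Matrix.vecMul v.1 AC = r • v.1 := congrArg Subtype.val hv.apply_eq_smul
  refine hv.2 (Subtype.ext (h r v.1 (fun j => ?_) fun j => ?_))
  · simpa [Matrix.vecMul, dotProduct, AC] using congrFun hv1 j
  · have h0 := (hW v.1).1 v.2 0
    simpa [Matrix.vecMul, dotProduct, BC] using congrFun h0 j

/-! ### Necessary conditions for controllability -/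

theorem hasDerivWithinAt_Ici_of_Icc {E : Type*} [NormedAddCommGroup E] [NormedSpace ℝ E]
    {f : ℝ → E} {f' : E} {T t : ℝ} (ht : t ∈ Set.Ico 0 T)
    (h : HasDerivWithinAt f f' (Set.Icc 0 T) t) : HasDerivWithinAt f f' (Set.Ici t) t :=
  h.mono_of_mem_nhdsWithin (Icc_mem_nhdsGE_of_mem ht)

/-- The rows of `[A B]` are linearly independent if the system is controllable. -/
theorem Controllable.eq_zero_of_left_kernel {n m : ℕ} {A : Matrix (Fin n) (Fin n) ℝ}
    {B : Matrix (Fin n) (Fin m) ℝ} (h : Controllable A B) {v : Fin n → ℝ}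
    (hA : Matrix.vecMul v A = 0) (hB : Matrix.vecMul v B = 0) : v = 0 := by
  -- Along any trajectory `v ⬝ᵥ x` is constant; steering from `0` to `v` forces `v ⬝ᵥ v = 0`.
  obtain ⟨T, hT, u, x, -, hx0, hxT, hx⟩ := h 0 v
  have hd : ∀ t ∈ Set.Icc 0 T, HasDerivWithinAt (fun t => v ⬝ᵥ x t) 0 (Set.Icc 0 T) t := by
    intro t ht
    have h1 : ∀ i, HasDerivWithinAt (fun t => x t i)
        ((A.mulVec (x t) + B.mulVec (u t)) i) (Set.Icc 0 T) t :=
      hasDerivWithinAt_pi.1 (hx t ht)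
    have h2 : HasDerivWithinAt (fun t => ∑ i, v i * x t i)
        (∑ i, v i * (A.mulVec (x t) + B.mulVec (u t)) i) (Set.Icc 0 T) t :=
      HasDerivWithinAt.fun_sum fun i _ => (h1 i).const_mul (v i)
    refine h2.congr_deriv ?_
    change v ⬝ᵥ (A.mulVec (x t) + B.mulVec (u t)) = 0
    rw [dotProduct_add, Matrix.dotProduct_mulVec, Matrix.dotProduct_mulVec, hA, hB]
    simp
  have hc := constant_of_has_deriv_right_zero (fun t ht => (hd t ht).continuousWithinAt)
    (fun t ht => hasDerivWithinAt_Ici_of_Icc ht (hd t (Set.Ico_subset_Icc_self ht))) T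
    (Set.right_mem_Icc.2 hT.le)
  simp only [hx0, hxT, dotProduct_zero] at hc
  exact dotProduct_self_eq_zero.1 hc

/-- In a controllable system, a nonempty set of states is influenced from outside. -/
theorem Controllable.exists_ne_zero_of_nonempty {n m : ℕ} {A : Matrix (Fin n) (Fin n) ℝ}
    {B : Matrix (Fin n) (Fin m) ℝ} (h : Controllable A B) {S : Finset (Fin n)}
    (hS : S.Nonempty) (hA : ∀ i ∈ S, ∀ j ∉ S, A i j = 0) :
    ∃ i ∈ S, ∃ j, B i j ≠ 0 := by
  by_contra! hB
  obtain ⟨T, hT, u, x, -, hx0, hxT, hx⟩ := h 0 1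
  -- Without outside influence the coordinates in `S` solve an autonomous linear equation, so by
  -- uniqueness they stay zero and never reach the all-ones state.
  let y : ℝ → Fin n → ℝ := fun t i => if i ∈ S then x t i else 0
  let M : Matrix (Fin n) (Fin n) ℝ := fun i j => if i ∈ S then A i j else 0
  have hd : ∀ t ∈ Set.Icc 0 T, HasDerivWithinAt y (M.mulVec (y t)) (Set.Icc 0 T) t := by
    intro t ht
    refine hasDerivWithinAt_pi.2 fun i => ?_
    by_cases hi : i ∈ S
    · have h1 := hasDerivWithinAt_pi.1 (hx t ht) i
      simp only [y, hi, if_true]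
      refine h1.congr_deriv ?_
      simp only [Matrix.mulVec, dotProduct, Pi.add_apply, M, hi, if_true, hB i hi, zero_mul,
        Finset.sum_const_zero, add_zero]
      refine Finset.sum_congr rfl fun j _ => ?_
      by_cases hj : j ∈ S
      · simp [hj]
      · simp [hj, hA i hi j hj]
    · simpa [y, hi, Matrix.mulVec, dotProduct, M] using
        hasDerivWithinAt_const t (Set.Icc 0 T) (0 : ℝ)
  have huniq := ODE_solution_unique (v := fun _ z => M.mulVec z) (g := fun _ => 0)
    (fun _ => (LinearMap.toContinuousLinearMap M.mulVecLin).lipschitz)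
    (fun t ht => (hd t ht).continuousWithinAt)
    (fun t ht => hasDerivWithinAt_Ici_of_Icc ht (hd t (Set.Ico_subset_Icc_self ht)))
    continuousOn_const
    (fun t _ => by simpa using hasDerivWithinAt_const t (Set.Ici t) (0 : Fin n → ℝ))
    (by ext i; simp [y, hx0]) (Set.right_mem_Icc.2 hT.le)
  obtain ⟨i, hi⟩ := hS
  simpa [y, hi, hxT] using congrFun huniq i

/-! ### Matchings and accessible source components -/

/-- A matching of the bipartite graph of `(A, B)` that covers all left state vertices: the
state `x_i` is matched with the state `j` for `σ i = inl j`, with the input `j` for `σ i = inr j`. -/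
def IsLeftMatching {n m : ℕ} (A : StructuredMatrix n n) (B : StructuredMatrix n m)
    (σ : Fin n → Fin n ⊕ Fin m) : Prop :=
  Function.Injective σ ∧ ∀ i, Sum.elim (A i) (B i) (σ i) = true

theorem StructurallyControllable.exists_isLeftMatching {n m : ℕ} {A : StructuredMatrix n n}
    {B : StructuredMatrix n m} (h : StructurallyControllable A B) :
    ∃ σ, IsLeftMatching A B σ := by
  classical
  obtain ⟨A', hA', B', hB', hc⟩ := h
  let t : Fin n → Finset (Fin n ⊕ Fin m) := fun i =>
    Finset.univ.filter fun c => Sum.elim (A i) (B i) c = true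
  obtain ⟨σ, hσ, hσt⟩ := (Finset.all_card_le_biUnion_card_iff_exists_injective t).1 fun s => by
    let N := s.biUnion t
    let C : Fin n → Fin n ⊕ Fin m → ℝ := fun i => Sum.elim (A' i) (B' i)
    -- Hall's condition is a rank bound: the rows in `s` vanish outside the columns `N`, so they
    -- stay independent after restriction to `N`, and `s` has at most as many elements as `N`.
    have hli : LinearIndependent ℝ fun i : s => fun c : N => C i c := by
      rw [Fintype.linearIndependent_iff]
      intro g hg
      let v : Fin n → ℝ := fun i => if hi : i ∈ s then g ⟨i, hi⟩ else 0
      have hv : ∀ c, ∑ i, v i * C i c = 0 := by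
        intro c
        have h1 : ∑ i, v i * C i c = ∑ i : s, g i * C i c := by
          rw [← Finset.sum_subset (Finset.subset_univ s)
            (fun i _ hi => by simp [v, hi]), ← Finset.sum_coe_sort s]
          exact Finset.sum_congr rfl fun i _ => by simp [v]
        rw [h1]
        by_cases hcN : c ∈ N
        · simpa using congrFun hg ⟨c, hcN⟩
        · refine Finset.sum_eq_zero fun i _ => ?_
          have h2 : c ∉ t i := fun h3 => hcN (Finset.mem_biUnion.2 ⟨i, i.2, h3⟩)
          have h4 : C i c = 0 := by
            rcases c with j | j
            · exact hA' _ _ (by simpa [t] using h2)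
            · exact hB' _ _ (by simpa [t] using h2)
          simp [h4]
      have hv0 : v = 0 := hc.eq_zero_of_left_kernel (funext fun j => hv (Sum.inl j))
        (funext fun j => hv (Sum.inr j))
      intro i
      simpa [v] using congrFun hv0 i
    simpa using hli.fintype_card_le_finrank
  exact ⟨σ, hσ, fun i => by simpa [t] using hσt i⟩

theorem StructurallyControllable.linksInto_nonempty {n m : ℕ} {A : StructuredMatrix n n}
    {B : StructuredMatrix n m} (h : StructurallyControllable A B) {S : Finset (Fin n)}
    (hS : S ∈ sourceSCCs A) : (linksInto B S).Nonempty := by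
  obtain ⟨A', hA', B', hB', hc⟩ := h
  have hS' : IsSourceSCC A S := by simpa [sourceSCCs] using hS
  obtain ⟨i, hi, j, hij⟩ := hc.exists_ne_zero_of_nonempty hS'.1.1 fun i hi j hj =>
    hA' i j (by simpa [stateEdges] using hS'.2 j i hj hi)
  have hB : B i j = true := by
    by_contra hne
    exact hij (hB' i j (by simpa using hne))
  exact ⟨(j, i), by simp [linksInto, inputLinks, hB, hi]⟩

/-! ### Sufficiency through a generic realization -/

/-- A finite transcendence basis over `ℚ` would make `ℝ` countable. -/
theorem exists_algebraicIndependent_real (n : ℕ) :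
    ∃ d : Fin n → ℝ, AlgebraicIndependent ℚ d := by
  obtain ⟨s, hs⟩ := exists_isTranscendenceBasis ℚ ℝ
  have hinf : Infinite s := by
    by_contra hfin
    have := not_infinite_iff_finite.1 hfin
    have halg : Algebra.IsAlgebraic (Algebra.adjoin ℚ (Set.range ((↑) : s → ℝ))) ℝ :=
      hs.isAlgebraic
    have h1 := Algebra.IsAlgebraic.cardinalMk_le_max
      (Algebra.adjoin ℚ (Set.range ((↑) : s → ℝ))) ℝ
    have h2 : Cardinal.mk (Algebra.adjoin ℚ (Set.range ((↑) : s → ℝ))) ≤ Cardinal.aleph0 := by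
      rw [← Cardinal.mk_congr hs.1.aevalEquiv.toEquiv]
      exact MvPolynomial.cardinalMk_le_max.trans (by simp)
    have h3 : Cardinal.mk ℝ ≤ Cardinal.aleph0 := h1.trans (max_le h2 le_rfl)
    exact absurd h3 (not_le_of_gt (Cardinal.mk_real ▸ Cardinal.aleph0_lt_continuum))
  let e : Fin n ↪ s := Fin.valEmbedding.trans (Infinite.natEmbedding s)
  exact ⟨fun i => e i, hs.1.comp e e.injective⟩

/-- A field that is generated by a finite set has at most as many algebraically independent
elements. -/
theorem card_le_of_algebraicIndependent_of_mem_adjoin {F E ι : Type} [Field F] [Field E]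
    [Algebra F E] [Fintype ι] {d : ι → E} (hd : AlgebraicIndependent F d) (G : Finset E)
    (h : ∀ i, d i ∈ IntermediateField.adjoin F (G : Set E)) : Fintype.card ι ≤ G.card := by
  open scoped IntermediateField.algebraAdjoinAdjoin in
  let R := Algebra.adjoin F (G : Set E)
  let K := IntermediateField.adjoin F (G : Set E)
  have halg : Algebra.IsAlgebraic R K := inferInstance
  -- The field is algebraic over the ring generated by `G`, and that ring is a quotient of a
  -- polynomial ring in `G.card` variables.
  have hK : Algebra.trdeg F R + Algebra.trdeg R K = Algebra.trdeg F K :=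
    trdeg_add_eq F R (A := K)
  rw [trdeg_eq_zero (R := R) (A := K), add_zero] at hK
  have hR : Algebra.trdeg F R ≤ G.card := by
    have hsurj : Function.Surjective
        ((MvPolynomial.aeval (R := F) ((↑) : G → E)).rangeRestrict) :=
      AlgHom.rangeRestrict_surjective _
    have hrange : (MvPolynomial.aeval (R := F) ((↑) : G → E)).range = R := by
      rw [← Algebra.adjoin_range_eq_range_aeval]
      simp [R]
    rw [← hrange]
    exact (trdeg_le_of_surjective _ hsurj).trans (by simp)
  have hd' : AlgebraicIndependent F fun i => (⟨d i, h i⟩ : K) :=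
    AlgebraicIndependent.of_comp K.val hd
  have h1 := hd'.cardinalMk_le_trdeg
  rw [← hK] at h1
  simpa using h1.trans hR

/-- With `w i = v i * d i`, the case `r = 0` is the kernel hypothesis. If `r ≠ 0`, each `d j` with
`j` in the support `S` of `w` is a rational expression in `r` and the ratios of the `w i`. One
rational relation among these brings the number of generators below the size of `S`, contradicting
algebraic independence. -/
theorem eq_zero_of_left_eigenvector {n m : ℕ} {d : Fin n → ℂ} (hd : AlgebraicIndependent ℚ d)
    {A : Matrix (Fin n) (Fin n) ℚ} {B : Matrix (Fin n) (Fin m) ℚ}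
    (hker : ∀ v : Fin n → ℂ, (∀ j, ∑ i, v i * (A i j : ℂ) = 0) →
      (∀ j, ∑ i, v i * (B i j : ℂ) = 0) → v = 0)
    (hin : ∀ S : Finset (Fin n), S.Nonempty →
      ∃ i ∈ S, (∃ j ∉ S, A i j ≠ 0) ∨ ∃ j, B i j ≠ 0)
    {r : ℂ} {v : Fin n → ℂ} (hA : ∀ j, ∑ i, v i * (d i * (A i j : ℂ)) = r * v j)
    (hB : ∀ j, ∑ i, v i * (d i * (B i j : ℂ)) = 0) : v = 0 := by
  classical
  have hd0 : ∀ i, d i ≠ 0 := hd.ne_zero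
  obtain ⟨w, hw⟩ : ∃ w : Fin n → ℂ, ∀ i, w i = v i * d i := ⟨_, fun _ => rfl⟩
  suffices h : w = 0 by
    ext i
    simpa [hd0 i, hw] using congrFun h i
  simp only [← mul_assoc, ← hw] at hA hB
  by_cases hr : r = 0
  · exact hker w (fun j => by simp [hA j, hr]) hB
  have hA' : ∀ j, d j * ∑ i, w i * (A i j : ℂ) = r * w j := fun j => by
    rw [hA, hw]; ring
  by_contra hne
  let S : Finset (Fin n) := Finset.univ.filter fun i => w i ≠ 0
  have hS : ∀ i, i ∈ S ↔ w i ≠ 0 := by simp [S]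
  have hSne : S.Nonempty := by
    obtain ⟨i, hi⟩ := Function.ne_iff.1 hne
    exact ⟨i, (hS i).2 hi⟩
  -- The relation is a column of `A` outside the support, where the eigenvalue equation has right
  -- side zero, or a column of `B`.
  obtain ⟨i₀, hi₀, c, hc₀, hc⟩ : ∃ i₀ ∈ S, ∃ c : Fin n → ℚ, c i₀ ≠ 0 ∧
      ∑ i, w i * (c i : ℂ) = 0 := by
    obtain ⟨i, hi, ⟨j, hj, hij⟩ | ⟨j, hij⟩⟩ := hin S hSne
    · refine ⟨i, hi, fun i => A i j, hij, ?_⟩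
      have hwj : w j = 0 := by simpa [hS] using hj
      have := hA' j
      simpa [hwj, hd0 j] using this
    · exact ⟨i, hi, fun i => B i j, hij, hB j⟩
  have hc₀' : (c i₀ : ℂ) ≠ 0 := by exact_mod_cast hc₀
  have hsplit : ∀ x : Fin n → ℂ, ∑ i, x i = x i₀ + ∑ i ∈ Finset.univ.erase i₀, x i := fun x =>
    (Finset.add_sum_erase _ _ (Finset.mem_univ i₀)).symm
  obtain ⟨i₁, hi₁, hne₁⟩ : ∃ i₁ ∈ S, i₁ ≠ i₀ := by
    by_contra! hall
    rw [hsplit, Finset.sum_eq_zero, add_zero] at hc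
    · exact mul_ne_zero ((hS _).1 hi₀) hc₀' hc
    · intro i hi
      have : w i = 0 := by
        by_contra hwi
        exact (Finset.mem_erase.1 hi).1 (hall i ((hS i).2 hwi))
      simp [this]
  have hw₁ : w i₁ ≠ 0 := (hS _).1 hi₁
  -- Normalizing by `w i₁` saves one generator and the relation eliminates `w i₀`; adding `r` leaves
  -- at most `S.card - 1`.
  let G : Finset ℂ := insert r (((S.erase i₀).erase i₁).image fun i => w i / w i₁)
  have hG : G.card < S.card := by
    have h1 : G.card ≤ ((S.erase i₀).erase i₁).card + 1 :=
      (Finset.card_insert_le _ _).trans (Nat.succ_le_succ Finset.card_image_le)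
    have h2 := Finset.card_erase_add_one (Finset.mem_erase.2 ⟨hne₁, hi₁⟩)
    have h3 := Finset.card_erase_add_one hi₀
    omega
  let K := IntermediateField.adjoin ℚ (G : Set ℂ)
  have hGK : ∀ x ∈ G, x ∈ K := fun x hx => IntermediateField.subset_adjoin _ _ hx
  have hQK : ∀ q : ℚ, (q : ℂ) ∈ K := fun q => K.algebraMap_mem q
  have hwK' : ∀ i, i ≠ i₀ → w i / w i₁ ∈ K := by
    intro i hi
    by_cases hi1 : i = i₁
    · rw [hi1, div_self hw₁]; exact K.one_mem
    by_cases hiS : i ∈ S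
    · refine hGK _ (Finset.mem_insert_of_mem (Finset.mem_image.2 ⟨i, ?_, rfl⟩))
      simp [hi, hi1, hiS]
    · have : w i = 0 := by simpa [hS] using hiS
      simp [this, K.zero_mem]
  have hwK : ∀ i, w i / w i₁ ∈ K := by
    intro i
    by_cases hi : i = i₀
    · have h1 : w i₀ / w i₁ = -(∑ i ∈ Finset.univ.erase i₀, w i / w i₁ * (c i : ℂ)) / c i₀ := by
        rw [hsplit] at hc
        rw [eq_div_iff hc₀', div_mul_eq_mul_div, eq_neg_of_add_eq_zero_left hc, neg_div,
          Finset.sum_div]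
        simp only [div_mul_eq_mul_div]
      rw [hi, h1]
      exact K.div_mem (K.neg_mem (K.sum_mem fun i hi =>
        K.mul_mem (hwK' i (Finset.mem_erase.1 hi).1) (hQK _))) (hQK _)
    · exact hwK' i hi
  have hdK : ∀ j : S, d j ∈ K := by
    intro j
    have hj := (hS j).1 j.2
    have h1 : d j * ∑ i, w i / w i₁ * (A i j : ℂ) = r * (w j / w i₁) := by
      simp only [div_mul_eq_mul_div, ← Finset.sum_div]
      rw [← mul_div_assoc, hA', mul_div_assoc]
    have h2 : ∑ i, w i / w i₁ * (A i j : ℂ) ≠ 0 := fun h0 => by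
      rw [h0, mul_zero] at h1
      exact mul_ne_zero hr (div_ne_zero hj hw₁) h1.symm
    rw [eq_div_of_mul_eq h2 h1]
    exact K.div_mem (K.mul_mem (hGK r (Finset.mem_insert_self _ _)) (hwK j))
      (K.sum_mem fun i _ => K.mul_mem (hwK i) (hQK _))
  have hcard := card_le_of_algebraicIndependent_of_mem_adjoin
    (hd.comp ((↑) : S → Fin n) Subtype.val_injective) G hdK
  rw [Fintype.card_coe] at hcard
  omega

/-- A matrix with the entries `n` on a matching has linearly independent rows, if the other entries
in the matched columns have absolute value at most `1`. -/
theorem eq_zero_of_left_kernel_of_dominant {n : ℕ} {γ : Type*} {C : Fin n → γ → ℚ}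
    {σ : Fin n → γ} (hdiag : ∀ i, C i (σ i) = n)
    (hoff : ∀ i j, i ≠ j → |C i (σ j)| ≤ 1) {v : Fin n → ℂ}
    (hv : ∀ c, ∑ i, v i * (C i c : ℂ) = 0) : v = 0 := by
  classical
  rcases isEmpty_or_nonempty (Fin n) with hn | hn
  · exact Subsingleton.elim _ _
  -- For a largest `‖v k‖`, the column matched with `k` gives `n * ‖v k‖ ≤ (n - 1) * ‖v k‖`.
  obtain ⟨k, hk⟩ := Finite.exists_max fun i => ‖v i‖
  have h1 := hv (σ k)
  rw [← Finset.add_sum_erase _ _ (Finset.mem_univ k), hdiag] at h1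
  have h2 : ‖v k * (n : ℂ)‖ ≤ (n - 1 : ℕ) * ‖v k‖ := by
    have h3 : v k * (n : ℂ) = -∑ i ∈ Finset.univ.erase k, v i * (C i (σ k) : ℂ) := by
      exact_mod_cast eq_neg_of_add_eq_zero_left h1
    rw [h3, norm_neg]
    refine (norm_sum_le_of_le (f := fun i => v i * (C i (σ k) : ℂ)) _
      (n := fun _ => ‖v k‖) fun i hi => ?_).trans ?_
    · rw [norm_mul]
      have h4 : ‖(C i (σ k) : ℂ)‖ ≤ 1 := by
        have := hoff i k (Finset.mem_erase.1 hi).1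
        rw [Complex.norm_ratCast]
        exact_mod_cast this
      exact (mul_le_of_le_one_right (norm_nonneg _) h4).trans (hk i)
    · simp [Finset.card_erase_of_mem]
  have hn1 : 1 ≤ n := Fin.pos_iff_nonempty.2 hn
  rw [norm_mul, Complex.norm_natCast, Nat.cast_sub hn1] at h2
  have h5 : ‖v k‖ = 0 := le_antisymm (by push_cast at h2; nlinarith) (norm_nonneg _)
  ext i
  exact norm_le_zero_iff.1 ((hk i).trans h5.le)

/-- Every nonempty set of states has an incoming edge or input link from outside. -/
theorem exists_incoming_of_linksInto_nonempty {n m : ℕ} {A : StructuredMatrix n n}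
    {B : StructuredMatrix n m} (h : ∀ S ∈ sourceSCCs A, (linksInto B S).Nonempty)
    {S : Finset (Fin n)} (hS : S.Nonempty) :
    ∃ i ∈ S, (∃ j ∉ S, A i j = true) ∨ ∃ j, B i j = true := by
  classical
  by_contra! hcl
  have hclosed : ∀ i j, Reach A i j → j ∈ S → i ∈ S := by
    intro i j hij hj
    induction hij using Relation.ReflTransGen.head_induction_on with
    | refl => exact hj
    | head hab _ ih =>
      by_contra hne
      exact (hcl _ ih).1 _ hne (by simpa [stateEdges] using hab)
  -- A state of `S` with the fewest ancestors is reachable from and reaches each of them, so its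
  -- ancestors form a source SCC. This SCC lies in `S`, as `S` has no incoming edge.
  let pre : Fin n → Finset (Fin n) := fun i => Finset.univ.filter fun j => Reach A j i
  obtain ⟨s, hs, hmin⟩ := Finset.exists_min_image S (fun i => (pre i).card) hS
  have hrefl : s ∈ pre s :=
    Finset.mem_filter.2 ⟨Finset.mem_univ _, Relation.ReflTransGen.refl⟩
  have hback : ∀ j, Reach A j s → Reach A s j := by
    intro j hj
    have hsub : pre j ⊆ pre s := fun l hl => by
      simp only [pre, Finset.mem_filter, Finset.mem_univ, true_and] at hl ⊢
      exact hl.trans hj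
    have heq := Finset.eq_of_subset_of_card_le hsub (hmin j (hclosed j s hj hs))
    have hmem : s ∈ pre j := heq.symm ▸ hrefl
    simpa [pre] using hmem
  have hsrc : pre s ∈ sourceSCCs A := by
    simp only [sourceSCCs, Finset.mem_filter, Finset.mem_univ, true_and]
    refine ⟨⟨⟨s, hrefl⟩, fun i hi j => ?_⟩,
      fun i j hi hj hij => hi ?_⟩
    · simp only [pre, Finset.mem_filter, Finset.mem_univ, true_and] at hi ⊢
      exact ⟨fun hj => ⟨hi.trans (hback j hj), hj.trans (hback i hi)⟩, fun hj => hj.2.trans hi⟩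
    · simp only [pre, Finset.mem_filter, Finset.mem_univ, true_and] at hj ⊢
      exact Relation.ReflTransGen.head hij hj
  obtain ⟨e, he⟩ := h _ hsrc
  simp only [linksInto, inputLinks, Finset.mem_filter, Finset.mem_univ, true_and, pre] at he
  exact (hcl e.2 (hclosed _ s he.2 hs)).2 e.1 he.1

/-- Structural controllability follows from a matching that covers the left state vertices and the
accessibility of all source components. -/
theorem IsLeftMatching.structurallyControllable {n m : ℕ} {A : StructuredMatrix n n}
    {B : StructuredMatrix n m} {σ : Fin n → Fin n ⊕ Fin m} (hσ : IsLeftMatching A B σ)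
    (h : ∀ S ∈ sourceSCCs A, (linksInto B S).Nonempty) : StructurallyControllable A B := by
  classical
  obtain ⟨d, hd⟩ := exists_algebraicIndependent_real n
  -- The value `n` on the matching dominates the other `n - 1` entries of a matched column, each 0
  -- or 1.
  let C : Fin n → Fin n ⊕ Fin m → ℚ := fun i c =>
    if σ i = c then n else if Sum.elim (A i) (B i) c = true then 1 else 0
  have hC : ∀ i c, C i c ≠ 0 ↔ Sum.elim (A i) (B i) c = true := by
    intro i c
    have hn : (n : ℚ) ≠ 0 := by exact_mod_cast (i.pos).ne'
    by_cases hc : σ i = c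
    · simp [C, hc, hn, hc ▸ hσ.2 i]
    · simp [C, hc]
  have hd' : AlgebraicIndependent ℚ fun i => (d i : ℂ) :=
    hd.map' (f := IsScalarTower.toAlgHom ℚ ℝ ℂ) Complex.ofReal_injective
  refine ⟨fun i j => d i * C i (Sum.inl j), fun i j hij => ?_,
    fun i j => d i * C i (Sum.inr j), fun i j hij => ?_,
    controllable_of_left_eigenvector_eq_zero fun r v hvA hvB => ?_⟩
  · have h0 : C i (Sum.inl j) = 0 := by simpa [hij] using (hC i (Sum.inl j)).not
    simp [h0]
  · have h0 : C i (Sum.inr j) = 0 := by simpa [hij] using (hC i (Sum.inr j)).not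
    simp [h0]
  refine eq_zero_of_left_eigenvector (r := r) hd' (A := fun i j => C i (Sum.inl j))
    (B := fun i j => C i (Sum.inr j)) (fun v h1 h2 => ?_) (fun S hS => ?_)
    (by simpa using hvA) (by simpa using hvB)
  · refine eq_zero_of_left_kernel_of_dominant (σ := σ) (C := C) (fun i => by simp [C])
      (fun i j hij => ?_) (Sum.rec h1 h2)
    have hne : σ i ≠ σ j := fun he => hij (hσ.1 he)
    simp only [C, hne, if_false]
    split_ifs <;> simp
  · simpa [hC] using exists_incoming_of_linksInto_nonempty h hS

theorem structurallyControllable_iff {n m : ℕ} {A : StructuredMatrix n n}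
    {B : StructuredMatrix n m} : StructurallyControllable A B ↔
      (∃ σ, IsLeftMatching A B σ) ∧ ∀ S ∈ sourceSCCs A, (linksInto B S).Nonempty :=
  ⟨fun h => ⟨h.exists_isLeftMatching, fun _ hS => h.linksInto_nonempty hS⟩,
    fun ⟨⟨_, hσ⟩, h⟩ => hσ.structurallyControllable h⟩

/-! ### Selections and feasible points of the integer programs -/

theorem exists_inputLinks_eq {n m : ℕ} (L : Finset (Fin m × Fin n)) :
    ∃ B : StructuredMatrix n m, inputLinks B = L :=
  ⟨fun i j => decide ((j, i) ∈ L), by ext; simp [inputLinks]⟩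

theorem sourceSCCs_eq_of_mem {n : ℕ} {A : StructuredMatrix n n} (S S' : sourceSCCs A) {i : Fin n}
    (hi : i ∈ S.1) (hi' : i ∈ S'.1) : S = S' := by
  classical
  have h : IsSCC A S.1 := (Finset.mem_filter.1 S.2).2.1
  have h' : IsSCC A S'.1 := (Finset.mem_filter.1 S'.2).2.1
  exact Subtype.ext (Finset.ext fun j => (h.2 i hi j).trans (h'.2 i hi' j).symm)

/-- Distinct SCCs are disjoint, so no link is charged to two of them. -/
theorem injective_of_mem_linksInto {n m : ℕ} {A : StructuredMatrix n n} {B : StructuredMatrix n m}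
    {f : sourceSCCs A → Fin m × Fin n} (hf : ∀ S, f S ∈ linksInto B S.1) :
    Function.Injective f := fun S S' h =>
  sourceSCCs_eq_of_mem S S' (Finset.mem_filter.1 (hf S)).2 (h ▸ (Finset.mem_filter.1 (hf S')).2)

/-- The common form of the objectives of the integer programs, with a cost `c` for each input link
and a penalty `p` for each source component. -/
noncomputable def Variables.objective {n m : ℕ} {A : StructuredMatrix n n}
    {B : StructuredMatrix n m} (c : Fin m × Fin n → ℝ) (p : sourceSCCs A → ℝ)
    (v : Variables A B) : ℝ :=
  ∑ e : inputLinks B, c e.1 * v.yU e + ∑ S, (1 - v.z S) * p S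

theorem Variables.count_eq_objective {n m : ℕ} {A : StructuredMatrix n n}
    {B : StructuredMatrix n m} (v : Variables A B) :
    v.count = v.objective (fun _ => 1) fun _ => 1 := by
  simp [Variables.count, Variables.objective, add_sub_assoc]

theorem minCost_eq {n m : ℕ} {B : StructuredMatrix n m} {w : Matrix (Fin n) (Fin m) ℝ}
    {S : Finset (Fin n)} {s : Fin m × Fin n} (hs : s ∈ linksInto B S)
    (hmin : ∀ e ∈ linksInto B S, w s.2 s.1 ≤ w e.2 e.1) : minCost B w S = w s.2 s.1 :=
  IsLeast.csInf_eq ⟨⟨s, hs, rfl⟩, by rintro _ ⟨e, he, rfl⟩; exact hmin e he⟩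

/-- The left equations provide a partner for each state; the right inequalities forbid using it
twice. -/
theorem Variables.IsFeasible.exists_isLeftMatching {n m : ℕ} {A : StructuredMatrix n n}
    {B : StructuredMatrix n m} {v : Variables A B} (hv : v.IsFeasible) {B' : StructuredMatrix n m}
    (hB' : matLinks v ⊆ inputLinks B') : ∃ σ, IsLeftMatching A B' σ := by
  classical
  have hX0 : ∀ e, 0 ≤ v.yX e := fun e => by rcases hv.binary_yX e with h | h <;> simp [h]
  have hU0 : ∀ e, 0 ≤ v.yU e := fun e => by rcases hv.binary_yU e with h | h <;> simp [h]
  have hex : ∀ i, ∃ c : Fin n ⊕ Fin m,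
      Sum.elim (fun j => ∃ h : (j, i) ∈ stateEdges A, v.yX ⟨(j, i), h⟩ = 1)
        (fun j => ∃ h : (j, i) ∈ inputLinks B, v.yU ⟨(j, i), h⟩ = 1) c := by
    intro i
    by_contra! hno
    have h1 : ∑ e : stateEdges A with e.1.2 = i, v.yX e = 0 := by
      refine Finset.sum_eq_zero fun e he => (hv.binary_yX e).resolve_right fun h => ?_
      obtain ⟨⟨j, i'⟩, hm⟩ := e
      obtain rfl : i' = i := (Finset.mem_filter.1 he).2
      exact hno (Sum.inl j) ⟨_, h⟩
    have h2 : ∑ e : inputLinks B with e.1.2 = i, v.yU e = 0 := by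
      refine Finset.sum_eq_zero fun e he => (hv.binary_yU e).resolve_right fun h => ?_
      obtain ⟨⟨j, i'⟩, hm⟩ := e
      obtain rfl : i' = i := (Finset.mem_filter.1 he).2
      exact hno (Sum.inr j) ⟨_, h⟩
    have := hv.left i
    rw [h1, h2] at this
    norm_num at this
  choose σ hσ using hex
  refine ⟨σ, fun i i' hii => ?_, fun i => ?_⟩
  · by_contra hne
    have hi := hσ i
    have hi' := hσ i'
    rw [← hii] at hi'
    rcases hc : σ i with j | j
    · rw [hc] at hi hi'
      obtain ⟨h, hy⟩ := hi
      obtain ⟨h', hy'⟩ := hi'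
      have hle := (Finset.add_le_sum (fun e _ => hX0 e) (s := Finset.univ.filter
        fun e : stateEdges A => e.1.1 = j) (i := ⟨(j, i), h⟩) (j := ⟨(j, i'), h'⟩)
        (by simp) (by simp) (by simpa using hne)).trans (hv.right_state j)
      rw [hy, hy'] at hle
      norm_num at hle
    · rw [hc] at hi hi'
      obtain ⟨h, hy⟩ := hi
      obtain ⟨h', hy'⟩ := hi'
      have hle := (Finset.add_le_sum (fun e _ => hU0 e) (s := Finset.univ.filter
        fun e : inputLinks B => e.1.1 = j) (i := ⟨(j, i), h⟩) (j := ⟨(j, i'), h'⟩)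
        (by simp) (by simp) (by simpa using hne)).trans (hv.right_input j)
      rw [hy, hy'] at hle
      norm_num at hle
  · have hi := hσ i
    rcases hc : σ i with j | j
    · rw [hc] at hi
      simpa [stateEdges] using hi.1
    · rw [hc] at hi
      have : (j, i) ∈ inputLinks B' := hB' hi
      simpa [inputLinks] using this

/-- A feasible point of the integer programs yields a selection which is not more expensive. -/
theorem Variables.IsFeasible.exists_selection {n m : ℕ} {A : StructuredMatrix n n}
    {B : StructuredMatrix n m} {sel : sourceSCCs A → Fin m × Fin n}
    (hsel : ∀ S, sel S ∈ linksInto B S.1) {v : Variables A B} (hv : v.IsFeasible) :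
    ∃ B' : StructuredMatrix n m,
      (inputLinks B' : Set (Fin m × Fin n)) = matLinks v ∪ reaLinks sel v ∧
      B' ∈ selections A B ∧
      ∀ c : Fin m × Fin n → ℝ, (∀ e ∈ inputLinks B, 0 ≤ c e) →
        ∑ e ∈ inputLinks B', c e ≤ v.objective c fun S => c (sel S) := by
  classical
  let M : Finset (Fin m × Fin n) := (inputLinks B).filter (· ∈ matLinks v)
  let Z : Finset (sourceSCCs A) := Finset.univ.filter fun S => v.z S = 0
  have hselB : ∀ S, sel S ∈ inputLinks B := fun S => (Finset.mem_filter.1 (hsel S)).1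
  have hM : ∀ e, e ∈ M ↔ e ∈ matLinks v := fun e =>
    ⟨fun h => (Finset.mem_filter.1 h).2, fun h => Finset.mem_filter.2 ⟨h.1, h⟩⟩
  obtain ⟨B', hB'⟩ := exists_inputLinks_eq (M ∪ Z.image sel)
  have hcoe : (inputLinks B' : Set (Fin m × Fin n)) = matLinks v ∪ reaLinks sel v := by
    ext e
    simp [hB', hM, Z, reaLinks, eq_comm]
  obtain ⟨σ, hσ⟩ := hv.exists_isLeftMatching (B' := B') (hcoe ▸ Set.subset_union_left)
  refine ⟨B', hcoe, ⟨?_, hσ.structurallyControllable fun S hS => ?_⟩, fun c hc => ?_⟩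
  · rw [hB']
    refine Finset.union_subset (Finset.filter_subset _ _) (Finset.image_subset_iff.2 ?_)
    exact fun S _ => hselB S
  · rcases hv.binary_z ⟨S, hS⟩ with hz | hz
    · refine ⟨sel ⟨S, hS⟩, Finset.mem_filter.2 ⟨?_, (Finset.mem_filter.1 (hsel ⟨S, hS⟩)).2⟩⟩
      rw [hB']
      exact Finset.mem_union_right _ (Finset.mem_image_of_mem _ (by simp [Z, hz]))
    · have h1 := hv.scc ⟨S, hS⟩
      rw [hz] at h1
      obtain ⟨e, he, hne⟩ := Finset.exists_ne_zero_of_sum_ne_zero (zero_lt_one.trans_le h1).ne'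
      refine ⟨e.1, Finset.mem_filter.2 ⟨?_, (Finset.mem_filter.1 (Finset.mem_filter.1 he).2).2⟩⟩
      rw [hB']
      exact Finset.mem_union_left _ ((hM _).2 ⟨e.2, (hv.binary_yU e).resolve_left hne⟩)
  · rw [hB', Variables.objective]
    -- Only an inequality: `z S = 0` is allowed even when `sel S` is already a matched link.
    have h1 : ∑ e ∈ M ∪ Z.image sel, c e ≤ ∑ e ∈ M, c e + ∑ e ∈ Z.image sel, c e := by
      rw [← Finset.sum_union_inter]
      refine le_add_of_nonneg_right (Finset.sum_nonneg fun e he => hc e ?_)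
      exact (Finset.mem_filter.1 (Finset.mem_inter.1 he).1).1
    have h2 : ∑ e ∈ M, c e = ∑ e : inputLinks B, c e.1 * v.yU e := by
      rw [Finset.sum_filter, ← Finset.sum_coe_sort]
      refine Finset.sum_congr rfl fun e _ => ?_
      rcases hv.binary_yU e with h | h <;> simp [matLinks, h]
    have h3 : ∑ e ∈ Z.image sel, c e = ∑ S, (1 - v.z S) * c (sel S) := by
      rw [Finset.sum_image (injective_of_mem_linksInto hsel).injOn, Finset.sum_filter]
      refine Finset.sum_congr rfl fun S _ => ?_
      rcases hv.binary_z S with h | h <;> simp [h]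
    exact h1.trans_eq (by rw [h2, h3])

/-- A selection yields a feasible point of the integer programs which is not more expensive. -/
theorem exists_isFeasible_of_mem_selections {n m : ℕ} {A : StructuredMatrix n n}
    {B B' : StructuredMatrix n m} (hB' : B' ∈ selections A B) :
    ∃ v : Variables A B, v.IsFeasible ∧ ∀ (c : Fin m × Fin n → ℝ) (p : sourceSCCs A → ℝ),
      (∀ e ∈ inputLinks B, 0 ≤ c e) → (∀ S, ∀ e ∈ linksInto B S.1, p S ≤ c e) →
      v.objective c p ≤ ∑ e ∈ inputLinks B', c e := by
  classical
  obtain ⟨hsub, hsc⟩ := hB'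
  obtain ⟨⟨σ, hσ, hσt⟩, hne⟩ := structurallyControllable_iff.1 hsc
  choose pick hpick using fun S : sourceSCCs A => hne S.1 S.2
  have hσX : ∀ i j, σ i = Sum.inl j → (j, i) ∈ stateEdges A := fun i j h => by
    simpa [h, stateEdges] using hσt i
  have hσU' : ∀ i j, σ i = Sum.inr j → (j, i) ∈ inputLinks B' := fun i j h => by
    simpa [h, inputLinks] using hσt i
  -- `z` is as large as the constraint permits: it is 1 exactly when a matched link ends in the
  -- component.
  let v : Variables A B :=
    { yX := fun e => if σ e.1.2 = Sum.inl e.1.1 then 1 else 0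
      yU := fun e => if σ e.1.2 = Sum.inr e.1.1 then 1 else 0
      z := fun S => if ∃ e ∈ linksInto B S.1, σ e.2 = Sum.inr e.1 then 1 else 0 }
  refine ⟨v, ⟨fun i => ?_, fun j => ?_, fun j => ?_, fun S => ?_, fun e => ?_, fun e => ?_,
    fun S => ?_⟩, fun c p hc hp => ?_⟩
  · rcases h : σ i with j | j
    · rw [Finset.sum_eq_single_of_mem (⟨(j, i), hσX i j h⟩ : stateEdges A) (by simp),
        Finset.sum_eq_zero]
      · simp [v, h]
      · intro e he
        have : e.1.2 = i := (Finset.mem_filter.1 he).2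
        simp [v, this, h]
      · intro e he hej
        have h1 : e.1.2 = i := (Finset.mem_filter.1 he).2
        have h2 : j ≠ e.1.1 := fun h2 => hej (Subtype.ext (Prod.ext h2.symm h1))
        simp [v, h1, h, h2]
    · rw [Finset.sum_eq_zero, Finset.sum_eq_single_of_mem
        (⟨(j, i), hsub (hσU' i j h)⟩ : inputLinks B) (by simp)]
      · simp [v, h]
      · intro e he hej
        have h1 : e.1.2 = i := (Finset.mem_filter.1 he).2
        have h2 : j ≠ e.1.1 := fun h2 => hej (Subtype.ext (Prod.ext h2.symm h1))
        simp [v, h1, h, h2]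
      · intro e he
        have : e.1.2 = i := (Finset.mem_filter.1 he).2
        simp [v, this, h]
  · simp only [v, Finset.sum_boole]
    have hcard : (Finset.filter (fun e : stateEdges A => σ e.1.2 = Sum.inl e.1.1)
        (Finset.univ.filter fun e : stateEdges A => e.1.1 = j)).card ≤ 1 := by
      refine Finset.card_le_one.2 fun e he e' he' => ?_
      simp only [Finset.mem_filter, Finset.mem_univ, true_and] at he he'
      exact Subtype.ext (Prod.ext (he.1.trans he'.1.symm)
        (hσ (by rw [he.2, he'.2, he.1, he'.1])))
    exact_mod_cast hcard
  · simp only [v, Finset.sum_boole]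
    have hcard : (Finset.filter (fun e : inputLinks B => σ e.1.2 = Sum.inr e.1.1)
        (Finset.univ.filter fun e : inputLinks B => e.1.1 = j)).card ≤ 1 := by
      refine Finset.card_le_one.2 fun e he e' he' => ?_
      simp only [Finset.mem_filter, Finset.mem_univ, true_and] at he he'
      exact Subtype.ext (Prod.ext (he.1.trans he'.1.symm)
        (hσ (by rw [he.2, he'.2, he.1, he'.1])))
    exact_mod_cast hcard
  · have hU0 : ∀ e, 0 ≤ v.yU e := fun e => by simp only [v]; split_ifs <;> simp
    by_cases h : ∃ e ∈ linksInto B S.1, σ e.2 = Sum.inr e.1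
    · obtain ⟨e, he, hσe⟩ := id h
      have h1 : v.z S = v.yU ⟨e, (Finset.mem_filter.1 he).1⟩ := by simp [v, h, hσe]
      rw [h1]
      exact Finset.single_le_sum (fun e _ => hU0 e) (by simpa using he)
    · have h1 : v.z S = 0 := by simp only [v, h, if_false]
      rw [h1]
      exact Finset.sum_nonneg fun e _ => hU0 e
  · simp only [v]; split_ifs <;> simp
  · simp only [v]; split_ifs <;> simp
  · simp only [v]; split_ifs <;> simp
  · let M : Finset (Fin m × Fin n) := (inputLinks B).filter fun e => σ e.2 = Sum.inr e.1
    let Z : Finset (sourceSCCs A) :=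
      Finset.univ.filter fun S => ¬ ∃ e ∈ linksInto B S.1, σ e.2 = Sum.inr e.1
    have hpickB : ∀ S, pick S ∈ linksInto B S.1 := fun S =>
      Finset.mem_filter.2 ⟨hsub (Finset.mem_filter.1 (hpick S)).1,
        (Finset.mem_filter.1 (hpick S)).2⟩
    have h1 : ∑ e : inputLinks B, c e.1 * v.yU e = ∑ e ∈ M, c e := by
      rw [Finset.sum_filter, ← Finset.sum_coe_sort (inputLinks B)]
      exact Finset.sum_congr rfl fun e _ => by simp [v]
    have h2 : ∑ S, (1 - v.z S) * p S ≤ ∑ e ∈ Z.image pick, c e := by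
      rw [Finset.sum_image (injective_of_mem_linksInto hpick).injOn, Finset.sum_filter]
      refine Finset.sum_le_sum fun S _ => ?_
      simp only [v]
      split_ifs <;> simp [hp S _ (hpickB S)]
    -- Where `z S = 0` no matched link enters `S`, so the link of `B'` picked there is a further
    -- one.
    have hdisj : Disjoint M (Z.image pick) := by
      refine Finset.disjoint_left.2 fun e heM heZ => ?_
      obtain ⟨S, hS, rfl⟩ := Finset.mem_image.1 heZ
      exact (Finset.mem_filter.1 hS).2 ⟨_, hpickB S, (Finset.mem_filter.1 heM).2⟩
    have hsubset : M ∪ Z.image pick ⊆ inputLinks B' := by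
      refine Finset.union_subset (fun e he => ?_) (Finset.image_subset_iff.2 fun S _ =>
        (Finset.mem_filter.1 (hpick S)).1)
      exact hσU' _ _ (Finset.mem_filter.1 he).2
    calc v.objective c p ≤ ∑ e ∈ M, c e + ∑ e ∈ Z.image pick, c e :=
          add_le_add h1.le h2
      _ = ∑ e ∈ M ∪ Z.image pick, c e := (Finset.sum_union hdisj).symm
      _ ≤ ∑ e ∈ inputLinks B', c e :=
          Finset.sum_le_sum_of_subset_of_nonneg hsubset fun e he _ => hc e (hsub he)

theorem sparsity_eq_sum {n m : ℕ} (B : StructuredMatrix n m) :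
    (sparsity B : ℝ) = ∑ _e ∈ inputLinks B, (1 : ℝ) := by
  simp [sparsity]

end StructuredSystem

/-! ### Transfer of optimality -/

theorem mainTheorem7 {n m : ℕ} (A : StructuredMatrix n n) (B : StructuredMatrix n m)
    (w : Matrix (Fin n) (Fin m) ℝ) (k : ℕ)
    (hsc : StructurallyControllable A B)
    (hw : ∀ i j, B i j = true → 0 ≤ w i j)
    (sel : sourceSCCs A → Fin m × Fin n)
    (hsel : ∀ S, sel S ∈ linksInto B S.1) :
    -- the sparsest selection problem, with arbitrary links `sel i` into the source SCCs
    (∀ v : Variables A B, IsOptimalSolution Variables.count (ilpRegion A B) v →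
      ∃ B' : StructuredMatrix n m,
        (inputLinks B' : Set (Fin m × Fin n)) = matLinks v ∪ reaLinks sel v ∧
        IsOptimalSolution (fun B'' => (sparsity B'' : ℝ)) (selections A B) B') ∧
    -- the two minimum cost problems, with `sel i` of minimum cost
    ((∀ S, ∀ e ∈ linksInto B S.1, w (sel S).2 (sel S).1 ≤ w e.2 e.1) →
      (∀ v : Variables A B, IsOptimalSolution (Variables.cost w) (ilpRegion A B) v →
        ∃ B' : StructuredMatrix n m,
          (inputLinks B' : Set (Fin m × Fin n)) = matLinks v ∪ reaLinks sel v ∧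
          IsOptimalSolution (cost w) (selections A B) B') ∧
      (∀ v : Variables A B, IsOptimalSolution (Variables.cost w) (ilpSparseRegion A B k) v →
        ∃ B' : StructuredMatrix n m,
          (inputLinks B' : Set (Fin m × Fin n)) = matLinks v ∪ reaLinks sel v ∧
          IsOptimalSolution (cost w) (sparseSelections A B k) B')) := by
  have hw' : ∀ e ∈ inputLinks B, 0 ≤ w e.2 e.1 := fun e he =>
    hw _ _ (by simpa [inputLinks] using he)
  refine ⟨fun v hv => ?_, fun hmin => ?_⟩
  · obtain ⟨B', hcoe, hB', hle⟩ := Variables.IsFeasible.exists_selection hsel hv.1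
    refine ⟨B', hcoe, hB', fun B'' hB'' => ?_⟩
    obtain ⟨v', hv', hle'⟩ := exists_isFeasible_of_mem_selections hB''
    simp only [sparsity_eq_sum]
    refine (hle (fun _ => 1) fun _ _ => zero_le_one).trans ?_
    refine le_trans ?_ (hle' (fun _ => 1) (fun _ => 1) (fun _ _ => zero_le_one) fun _ _ _ => le_rfl)
    simpa only [Variables.count_eq_objective] using hv.2 v' hv'
  · have hcost : ∀ v : Variables A B, v.cost w =
        v.objective (fun e => w e.2 e.1) fun S => w (sel S).2 (sel S).1 := fun v => by
      simp only [Variables.cost, Variables.objective, minCost_eq (hsel _) (hmin _)]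
    refine ⟨fun v hv => ?_, fun v hv => ?_⟩
    · obtain ⟨B', hcoe, hB', hle⟩ := Variables.IsFeasible.exists_selection hsel hv.1
      refine ⟨B', hcoe, hB', fun B'' hB'' => ?_⟩
      obtain ⟨v', hv', hle'⟩ := exists_isFeasible_of_mem_selections hB''
      refine (hle (fun e => w e.2 e.1) hw').trans (le_trans ?_ (hle' _ _ hw' hmin))
      simpa only [hcost] using hv.2 v' hv'
    · obtain ⟨B', hcoe, hB', hle⟩ := Variables.IsFeasible.exists_selection hsel hv.1.1
      refine ⟨B', hcoe, ⟨hB', ?_⟩, fun B'' hB'' => ?_⟩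
      · have h1 := hle (fun _ => 1) fun _ _ => zero_le_one
        rw [← sparsity_eq_sum, ← Variables.count_eq_objective] at h1
        exact_mod_cast h1.trans hv.1.2
      · obtain ⟨v', hv', hle'⟩ := exists_isFeasible_of_mem_selections hB''.1
        -- Unit costs and penalties, applied to the same `v'`, show that the competitor meets the
        -- sparsity constraint of the program.
        have hk : v'.count ≤ k := by
          rw [Variables.count_eq_objective]
          refine (hle' _ _ (fun _ _ => zero_le_one) fun _ _ _ => le_rfl).trans ?_
          rw [← sparsity_eq_sum]
          exact_mod_cast hB''.2
        refine (hle (fun e => w e.2 e.1) hw').trans (le_trans ?_ (hle' _ _ hw' hmin))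
        simpa only [hcost] using hv.2 v' ⟨hv', hk⟩
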